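/- Let $n\ge 3$ be an integer, let $q_n=x_1^2+\cdots+x_n^2\in\mathbb{C}[x_1,\dots,x_n]$, and let $T_{n,2}=\binom{n+1}{2}$. A \emph{tight decomposition} of $q_n^2$ is an expression $$q_n^2=\sum_{k=1}^{T_{n,2}}(a_{k,1}x_1+\cdots+a_{k,n}x_n)^4$$ of $q_n^2$ as a sum of exactly $T_{n,2}$ fourth powers of linear forms with complex coefficients $a_{k,j}\in\mathbb{C}$. If $q_n^2$ has a tight decomposition, then $n=3$ or $n=m^2-2$ for some odd natural number $m$. -/

import Mathlib

open scoped BigOperators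

noncomputable section

/-- The quadratic form `q_n = x_1^2 + ... + x_n^2` in `ℂ[x_1, ..., x_n]`. -/
def qForm (n : ℕ) : MvPolynomial (Fin n) ℂ :=
  ∑ i : Fin n, MvPolynomial.X i ^ 2

/-- The linear form `a · x = a_1 x_1 + ... + a_n x_n` attached to `a ∈ ℂ^n`. -/
def linForm {n : ℕ} (a : Fin n → ℂ) : MvPolynomial (Fin n) ℂ :=
  ∑ i : Fin n, MvPolynomial.C (a i) * MvPolynomial.X i

/-- The number `T_{n,s} = binom (s+n-1) s` (used for `n ≥ 1`), which is the dimension of the space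
of forms of degree `s` in `n` variables. -/
def tightSize (n s : ℕ) : ℕ := Nat.choose (s + n - 1) s

/-- `f = ∑_k (a_k · x)^d`: a Waring decomposition of size `m` of the degree `d` form `f`. -/
def IsWaringDecomposition {n m : ℕ} (f : MvPolynomial (Fin n) ℂ) (d : ℕ)
    (a : Fin m → Fin n → ℂ) : Prop :=
  f = ∑ k : Fin m, linForm (a k) ^ d

/-- The points `a_1, ..., a_m ∈ ℂ^n` give a tight decomposition of `q_n^s`: one has
`q_n^s = ∑_k (a_k · x)^(2s)`, and the size `m` is `T_{n,s}`. -/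
def IsTightDecomposition (n s : ℕ) {m : ℕ} (a : Fin m → Fin n → ℂ) : Prop :=
  m = tightSize n s ∧ IsWaringDecomposition (qForm n ^ s) (2 * s) a

end

open scoped BigOperators Matrix

/-! Polarising and contracting the identity gives the moments of the points. They make the Gram
matrix of the squares of the points, for the form dual to `q_n ^ 2`, idempotent; tightness makes its
trace equal its size, so it is the identity (`dual_gram`). Up to fourth roots of unity the points
are thus equiangular, with cosines `±1 / w`, where `w ^ 2 = n + 2`. A second moment at two points
then expresses `(n - 3) * w` through integers, so `n + 2` is a square unless `n = 3`. If its root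
were even, an integer matrix that must be singular would reduce to the identity mod 2. -/

lemma eval_linForm {n : ℕ} (a x : Fin n → ℂ) : MvPolynomial.eval x (linForm a) = a ⬝ᵥ x := by
  simp [linForm, dotProduct]

lemma eval_qForm {n : ℕ} (x : Fin n → ℂ) : MvPolynomial.eval x (qForm n) = x ⬝ᵥ x := by
  simp [qForm, dotProduct, sq]

/-- A decomposition of `q_n ^ 2`, as an identity of functions on `ℂ ^ n`. -/
def IsQuarticDesign {n r : ℕ} (a : Fin r → Fin n → ℂ) : Prop :=
  ∀ x : Fin n → ℂ, ∑ k, (a k ⬝ᵥ x) ^ 4 = (x ⬝ᵥ x) ^ 2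

lemma IsTightDecomposition.isQuarticDesign {n r : ℕ} {a : Fin r → Fin n → ℂ}
    (h : IsTightDecomposition n 2 a) : IsQuarticDesign a := by
  intro x
  have h2 := congrArg (MvPolynomial.eval x) h.2
  simpa [eval_linForm, eval_qForm] using h2.symm

lemma two_mul_tightSize_two (n : ℕ) : 2 * tightSize n 2 = (n + 1) * n := by
  have h : tightSize n 2 = (n + 1).choose 2 := by
    rw [tightSize]
    congr 1
    omega
  rw [h, Nat.choose_two_right, Nat.add_sub_cancel]
  exact Nat.mul_div_cancel' (by simpa [mul_comm] using (Nat.even_mul_succ_self n).two_dvd)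

lemma Matrix.eq_one_of_isIdempotentElem_of_trace {ι K : Type*} [Fintype ι] [DecidableEq ι] [Field K]
    [CharZero K] {N : Matrix ι ι K} (hN : N * N = N) (ht : N.trace = Fintype.card ι) : N = 1 := by
  have h0 : Matrix.toLin' (1 - N) = 0 := by
    apply LinearMap.IsIdempotentElem.eq_zero_of_trace_eq_zero
    · rw [IsIdempotentElem, Module.End.mul_eq_comp, ← Matrix.toLin'_mul]
      congr 1
      simp [sub_mul, mul_sub, hN]
    · rw [Matrix.trace_toLin'_eq, Matrix.trace_sub, ht, Matrix.trace_one, sub_self]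
  rw [LinearEquiv.map_eq_zero_iff, sub_eq_zero] at h0
  exact h0.symm

namespace IsQuarticDesign

variable {n r : ℕ} {a : Fin r → Fin n → ℂ}

/-- Adding the identity at `x + y` and `x - y` isolates the terms even in `y`. -/
lemma sum_sq_mul_sq (h : IsQuarticDesign a) (x y : Fin n → ℂ) :
    3 * ∑ k, (a k ⬝ᵥ x) ^ 2 * (a k ⬝ᵥ y) ^ 2
      = (x ⬝ᵥ x) * (y ⬝ᵥ y) + 2 * (x ⬝ᵥ y) ^ 2 := by
  have hp := h (x + y)
  have hm := h (x - y)
  have hx := h x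
  have hy := h y
  have key : ∑ k, (a k ⬝ᵥ (x + y)) ^ 4 + ∑ k, (a k ⬝ᵥ (x - y)) ^ 4
      = 2 * ∑ k, (a k ⬝ᵥ x) ^ 4 + 2 * ∑ k, (a k ⬝ᵥ y) ^ 4
        + 12 * ∑ k, (a k ⬝ᵥ x) ^ 2 * (a k ⬝ᵥ y) ^ 2 := by
    simp only [Finset.mul_sum, ← Finset.sum_add_distrib]
    refine Finset.sum_congr rfl fun k _ => ?_
    rw [dotProduct_add, dotProduct_sub]
    ring
  rw [hp, hm, hx, hy] at key
  simp only [dotProduct_add, dotProduct_sub, add_dotProduct, sub_dotProduct,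
    dotProduct_comm y x] at key
  linear_combination (-1 / 4 : ℂ) * key

/-- Contraction: sum the previous moment over `x` in the standard basis. -/
lemma sum_self_mul_sq (h : IsQuarticDesign a) (y : Fin n → ℂ) :
    3 * ∑ k, (a k ⬝ᵥ a k) * (a k ⬝ᵥ y) ^ 2 = (n + 2) * (y ⬝ᵥ y) := by
  have hs : ∑ i : Fin n, (3 * ∑ k, (a k ⬝ᵥ Pi.single i 1) ^ 2 * (a k ⬝ᵥ y) ^ 2)
      = ∑ i : Fin n, (y ⬝ᵥ y + 2 * (y i) ^ 2) := by
    refine Finset.sum_congr rfl fun i _ => ?_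
    rw [h.sum_sq_mul_sq]
    simp
  rw [← Finset.mul_sum, Finset.sum_comm] at hs
  simp only [← Finset.sum_mul, Finset.sum_add_distrib, ← Finset.mul_sum, dotProduct_single_one] at hs
  simp only [Finset.sum_const, Finset.card_univ, Fintype.card_fin, nsmul_eq_mul] at hs
  have hd : ∀ v : Fin n → ℂ, ∑ i, v i ^ 2 = v ⬝ᵥ v := fun v => by simp [dotProduct, sq]
  simp only [hd] at hs
  linear_combination hs

lemma sum_self_mul_mul (h : IsQuarticDesign a) (x y : Fin n → ℂ) :
    3 * ∑ k, (a k ⬝ᵥ a k) * ((a k ⬝ᵥ x) * (a k ⬝ᵥ y)) = (n + 2) * (x ⬝ᵥ y) := by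
  have hp := h.sum_self_mul_sq (x + y)
  have hx := h.sum_self_mul_sq x
  have hy := h.sum_self_mul_sq y
  have key : ∑ k, (a k ⬝ᵥ a k) * (a k ⬝ᵥ (x + y)) ^ 2
      = ∑ k, (a k ⬝ᵥ a k) * (a k ⬝ᵥ x) ^ 2 + ∑ k, (a k ⬝ᵥ a k) * (a k ⬝ᵥ y) ^ 2
        + 2 * ∑ k, (a k ⬝ᵥ a k) * ((a k ⬝ᵥ x) * (a k ⬝ᵥ y)) := by
    simp only [Finset.mul_sum, ← Finset.sum_add_distrib]
    refine Finset.sum_congr rfl fun k _ => ?_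
    rw [dotProduct_add]
    ring
  simp only [dotProduct_add, add_dotProduct, dotProduct_comm y x] at hp key
  linear_combination (1 / 2 : ℂ) * (hp - hx - hy - 3 * key)

lemma sum_self_sq (h : IsQuarticDesign a) :
    3 * ∑ k, (a k ⬝ᵥ a k) ^ 2 = n * (n + 2) := by
  have hs : ∑ i : Fin n, (3 * ∑ k, (a k ⬝ᵥ a k) * (a k ⬝ᵥ Pi.single i 1) ^ 2)
      = ∑ i : Fin n, ((n : ℂ) + 2) := by
    refine Finset.sum_congr rfl fun i _ => ?_
    rw [h.sum_self_mul_sq]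
    simp
  rw [← Finset.mul_sum, Finset.sum_comm] at hs
  simp only [← Finset.mul_sum, dotProduct_single_one] at hs
  have hd : ∀ v : Fin n → ℂ, ∑ i, v i ^ 2 = v ⬝ᵥ v := fun v => by simp [dotProduct, sq]
  simp only [hd, ← sq] at hs
  simpa [-mul_eq_mul_left_iff, mul_add] using hs

/-- For a tight design the matrix of the dual form on the squares of the points is the identity. -/
lemma dual_gram (h : IsQuarticDesign a) (hr : 2 * r = (n + 1) * n) (k l : Fin r) :
    3 / 2 * ((a k ⬝ᵥ a l) ^ 2 - (a k ⬝ᵥ a k) * (a l ⬝ᵥ a l) / (n + 2))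
      = if k = l then 1 else 0 := by
  have hn : (n : ℂ) + 2 ≠ 0 := by exact_mod_cast (Nat.succ_ne_zero (n + 1))
  let N : Matrix (Fin r) (Fin r) ℂ := Matrix.of fun k l =>
    3 / 2 * ((a k ⬝ᵥ a l) ^ 2 - (a k ⬝ᵥ a k) * (a l ⬝ᵥ a l) / (n + 2))
  have hN : N = 1 := by
    apply Matrix.eq_one_of_isIdempotentElem_of_trace
    · ext i j
      have h1 := h.sum_sq_mul_sq (a i) (a j)
      have h2 := h.sum_self_mul_sq (a i)
      have h3 := h.sum_self_mul_sq (a j)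
      have h4 := h.sum_self_sq
      have hs : (N * N) i j = 9 / 4 * ∑ k, (a k ⬝ᵥ a i) ^ 2 * (a k ⬝ᵥ a j) ^ 2
          - 9 / 4 * (a j ⬝ᵥ a j) / (n + 2) * ∑ k, (a k ⬝ᵥ a k) * (a k ⬝ᵥ a i) ^ 2
          - 9 / 4 * (a i ⬝ᵥ a i) / (n + 2) * ∑ k, (a k ⬝ᵥ a k) * (a k ⬝ᵥ a j) ^ 2
          + 9 / 4 * (a i ⬝ᵥ a i) * (a j ⬝ᵥ a j) / (n + 2) ^ 2 * ∑ k, (a k ⬝ᵥ a k) ^ 2 := by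
        rw [Matrix.mul_apply]
        simp only [Finset.mul_sum, ← Finset.sum_add_distrib, ← Finset.sum_sub_distrib]
        refine Finset.sum_congr rfl fun k _ => ?_
        simp only [N, Matrix.of_apply, dotProduct_comm (a i) (a k)]
        field_simp
        ring
      rw [hs]
      simp only [N, Matrix.of_apply]
      field_simp
      linear_combination 6 * (n + 2) ^ 2 * h1 - 6 * (n + 2) * (a j ⬝ᵥ a j) * h2
        - 6 * (n + 2) * (a i ⬝ᵥ a i) * h3 + 6 * (a i ⬝ᵥ a i) * (a j ⬝ᵥ a j) * h4
    · have h4 := h.sum_self_sq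
      have hs : N.trace = 3 / 2 * ((n + 1) / (n + 2)) * ∑ k, (a k ⬝ᵥ a k) ^ 2 := by
        rw [Matrix.trace, Finset.mul_sum]
        refine Finset.sum_congr rfl fun k _ => ?_
        simp only [N, Matrix.of_apply, Matrix.diag_apply]
        field_simp
        ring
      have hr' : 2 * (r : ℂ) = (n + 1) * n := by exact_mod_cast hr
      rw [hs, Fintype.card_fin]
      field_simp
      linear_combination (n + 1) * h4 - (n + 2) * hr'
  have := congrFun (congrFun hN k) l
  simpa [N, Matrix.one_apply] using this

lemma smul (h : IsQuarticDesign a) {c : Fin r → ℂ} (hc : ∀ k, c k ^ 4 = 1) :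
    IsQuarticDesign fun k => c k • a k := by
  intro x
  rw [← h x]
  refine Finset.sum_congr rfl fun k _ => ?_
  rw [smul_dotProduct, smul_eq_mul, mul_pow, hc, one_mul]

/-- After multiplying the points of a tight design by fourth roots of unity, all of them have the
same nonzero norm, and their mutual products are equal up to sign. -/
lemma exists_equiangular (h : IsQuarticDesign a) (hr : 2 * r = (n + 1) * n) {w : ℂ}
    (hw : w ^ 2 = n + 2) :
    ∃ (b : Fin r → Fin n → ℂ) (ρ : ℂ) (s : Fin r → Fin r → ℤ), IsQuarticDesign b ∧
      3 * (n + 1) * ρ ^ 2 = 2 * (n + 2) ∧ (∀ k, b k ⬝ᵥ b k = ρ) ∧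
      (∀ k l, s k l ^ 2 = 1) ∧ ∀ k l, k ≠ l → w * (b k ⬝ᵥ b l) = s k l * ρ := by
  have hn : (n : ℂ) + 2 ≠ 0 := by exact_mod_cast (Nat.succ_ne_zero (n + 1))
  have hn1 : (n : ℂ) + 1 ≠ 0 := by exact_mod_cast (Nat.succ_ne_zero n)
  -- The diagonal of `dual_gram` forces this value of `ρ ^ 2`; scaling by `I` corrects a norm equal
  -- to `-ρ`.
  obtain ⟨ρ, hρ⟩ := IsAlgClosed.exists_pow_nat_eq (2 * (n + 2) / (3 * (n + 1)) : ℂ) two_pos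
  have hρ' : 3 * (n + 1) * ρ ^ 2 = 2 * ((n : ℂ) + 2) := by
    rw [hρ]
    field_simp
  have hc : ∀ k, ∃ c : ℂ, c ^ 4 = 1 ∧ c ^ 2 * (a k ⬝ᵥ a k) = ρ := by
    intro k
    have hk := h.dual_gram hr k k
    rw [if_pos rfl] at hk
    field_simp at hk
    have : (a k ⬝ᵥ a k) ^ 2 = ρ ^ 2 := by
      rw [hρ]
      field_simp
      linear_combination hk
    rcases sq_eq_sq_iff_eq_or_eq_neg.mp this with h1 | h1
    · exact ⟨1, by simp, by simp [h1]⟩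
    · exact ⟨Complex.I, by simp, by simp [h1]⟩
  choose c hc4 hc2 using hc
  have hb := h.smul hc4
  have hbρ : ∀ k, (c k • a k) ⬝ᵥ (c k • a k) = ρ := fun k => by
    rw [smul_dotProduct, dotProduct_smul, smul_eq_mul, smul_eq_mul, ← hc2 k]
    ring
  have hs : ∀ k l, ∃ s : ℤ, s ^ 2 = 1 ∧
      (k ≠ l → w * ((c k • a k) ⬝ᵥ (c l • a l)) = s * ρ) := by
    intro k l
    by_cases hkl : k = l
    · exact ⟨1, by simp, fun h => absurd hkl h⟩
    have hd := hb.dual_gram hr k l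
    rw [if_neg hkl] at hd
    simp only [hbρ] at hd
    have : (w * ((c k • a k) ⬝ᵥ (c l • a l))) ^ 2 = ρ ^ 2 := by
      rw [mul_pow, hw]
      field_simp at hd
      linear_combination (1 / 3 : ℂ) * hd
    rcases sq_eq_sq_iff_eq_or_eq_neg.mp this with h1 | h1
    · exact ⟨1, by simp, fun _ => by rw [h1]; simp⟩
    · exact ⟨-1, by simp, fun _ => by rw [h1]; simp⟩
  choose s hs1 hs2 using hs
  exact ⟨_, ρ, s, hb, hρ', hbρ, hs1, hs2⟩

lemma isSquare_add_two (h : IsQuarticDesign a) (hr : 2 * r = (n + 1) * n) (hn : 4 ≤ n) :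
    IsSquare (n + 2) := by
  obtain ⟨w, hw⟩ := IsAlgClosed.exists_pow_nat_eq (n + 2 : ℂ) two_pos
  obtain ⟨b, ρ, s, hb, hρ, hbρ, hs, hbs⟩ := h.exists_equiangular hr hw
  have hn2 : (n : ℂ) + 2 ≠ 0 := by exact_mod_cast (Nat.succ_ne_zero (n + 1))
  have hρ0 : ρ ≠ 0 := by
    rintro rfl
    simp [hn2] at hρ
  have hr2 : 1 < r := by nlinarith
  let i : Fin r := ⟨0, by omega⟩
  let j : Fin r := ⟨1, hr2⟩
  have hij : i ≠ j := by simp [i, j, Fin.ext_iff]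
  have hsum := hb.sum_self_mul_mul (b i) (b j)
  simp only [hbρ, ← Finset.mul_sum] at hsum
  -- The terms `k = i` and `k = j` are split off because each has a factor of norm `ρ` and so
  -- carries an extra `w`.
  let Z : ℤ := ∑ k ∈ (Finset.univ.erase i).erase j, s k i * s k j
  have hZ : w ^ 2 * ∑ k, (b k ⬝ᵥ b i) * (b k ⬝ᵥ b j) = 2 * w * s i j * ρ ^ 2 + Z * ρ ^ 2 := by
    rw [← Finset.add_sum_erase _ _ (Finset.mem_univ i),
      ← Finset.add_sum_erase _ _ (Finset.mem_erase.mpr ⟨hij.symm, Finset.mem_univ j⟩),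
      hbρ, hbρ, dotProduct_comm (b j) (b i), mul_add, mul_add, Finset.mul_sum]
    have : ∑ k ∈ (Finset.univ.erase i).erase j, w ^ 2 * ((b k ⬝ᵥ b i) * (b k ⬝ᵥ b j))
        = Z * ρ ^ 2 := by
      push_cast [Z]
      rw [Finset.sum_mul]
      refine Finset.sum_congr rfl fun k hk => ?_
      simp only [Finset.mem_erase, Finset.mem_univ, and_true] at hk
      linear_combination (w * (b k ⬝ᵥ b j)) * hbs k i hk.2 + s k i * ρ * hbs k j hk.1
    rw [this]
    linear_combination 2 * w * ρ * hbs i j hij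
  have hlin : 2 * (Z : ℂ) = (n - 3) * s i j * w := by
    have h1 : (ρ * (n + 2)) * (2 * (Z : ℂ) - (n - 3) * s i j * w) = 0 := by
      have := hbs i j hij
      linear_combination -(ρ * (2 * w * s i j + Z)) * hρ - 3 * (n + 1) * ρ * hZ
        + w ^ 2 * (n + 1) * hsum + (n + 1) * (n + 2) * w * this
    exact sub_eq_zero.mp ((mul_eq_zero.mp h1).resolve_left (mul_ne_zero hρ0 hn2))
  have hsq : (2 * Z) ^ 2 = ((n : ℤ) - 3) ^ 2 * ((n : ℤ) + 2) := by
    have hsc : (s i j : ℂ) ^ 2 = 1 := by exact_mod_cast hs i j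
    have : (2 * (Z : ℂ)) ^ 2 = ((n : ℂ) - 3) ^ 2 * ((n : ℂ) + 2) := by
      rw [hlin, mul_pow, mul_pow, hsc, hw, mul_one]
    exact_mod_cast this
  have hdvd : ((n : ℤ) - 3) ∣ 2 * Z := (Int.pow_dvd_pow_iff two_ne_zero).mp ⟨_, hsq⟩
  obtain ⟨t, ht⟩ := hdvd
  rw [ht, mul_pow] at hsq
  have hn3 : ((n : ℤ) - 3) ^ 2 ≠ 0 := pow_ne_zero _ (by omega)
  have ht2 := mul_left_cancel₀ hn3 hsq
  refine ⟨t.natAbs, ?_⟩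
  zify
  rw [← ht2, ← sq, sq_abs]

lemma odd_of_sq_eq (h : IsQuarticDesign a) (hr : 2 * r = (n + 1) * n) (hn : 4 ≤ n) {m : ℕ}
    (hm : m ^ 2 = n + 2) : Odd m := by
  have hmc : (m : ℂ) ^ 2 = n + 2 := by exact_mod_cast hm
  obtain ⟨b, ρ, s, hb, hρ, hbρ, hs, hbs⟩ := h.exists_equiangular hr hmc
  have hn2 : (n : ℂ) + 2 ≠ 0 := by exact_mod_cast (Nat.succ_ne_zero (n + 1))
  have hρ0 : ρ ≠ 0 := by
    rintro rfl
    simp [hn2] at hρ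
  -- As `r > n + 1`, some nonzero `x` is a linear relation among the points with coefficient sum
  -- zero.
  let f : (Fin r → ℂ) →ₗ[ℂ] (Fin n → ℂ) × ℂ :=
    (Matrix.vecMulLinear (Matrix.of b)).prod (∑ k, LinearMap.proj k)
  have hker : LinearMap.ker f ≠ ⊥ := by
    apply LinearMap.ker_ne_bot_of_finrank_lt
    simp only [Module.finrank_prod, Module.finrank_fin_fun, Module.finrank_self]
    nlinarith
  obtain ⟨x, hx, hx0⟩ := Submodule.exists_mem_ne_zero_of_ne_bot hker
  have hx1 : x ᵥ* Matrix.of b = 0 := congrArg Prod.fst (LinearMap.mem_ker.mp hx)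
  have hx2 : ∑ k, x k = 0 := by
    have := congrArg Prod.snd (LinearMap.mem_ker.mp hx)
    simpa [f] using this
  -- This is `m / ρ` times the Gram matrix plus the all-ones matrix; both summands kill `x`. Off the
  -- diagonal `s k l + 1` is even.
  let W : Matrix (Fin r) (Fin r) ℤ := Matrix.of fun k l => if k = l then (m : ℤ) + 1 else s k l + 1
  have hWx : W.map (Int.castRingHom ℂ) *ᵥ x = 0 := by
    ext k
    have hk : ∑ l, x l * (b l ⬝ᵥ b k) = 0 := by
      have : (x ᵥ* Matrix.of b) ⬝ᵥ b k = 0 := by rw [hx1, zero_dotProduct]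
      rw [← Matrix.dotProduct_mulVec] at this
      exact this
    have hterm : ∀ l, ρ * ((W.map (Int.castRingHom ℂ)) k l * x l)
        = m * (x l * (b l ⬝ᵥ b k)) + ρ * x l := by
      intro l
      by_cases hkl : k = l
      · subst hkl
        simp only [W, Matrix.map_apply, Matrix.of_apply, if_true, hbρ]
        simp
        ring
      · simp only [W, Matrix.map_apply, Matrix.of_apply, if_neg hkl]
        have := hbs k l hkl
        rw [dotProduct_comm (b l) (b k)]
        simp
        linear_combination (-x l) * this
    have hz : ρ * (W.map (Int.castRingHom ℂ) *ᵥ x) k = 0 := by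
      rw [Matrix.mulVec, dotProduct, Finset.mul_sum]
      simp only [hterm, Finset.sum_add_distrib, ← Finset.mul_sum, hk, hx2, mul_zero, add_zero]
    exact (mul_eq_zero.mp hz).resolve_left hρ0
  have hdet : W.det = 0 := by
    have h1 := Matrix.exists_mulVec_eq_zero_iff.mp ⟨x, hx0, hWx⟩
    rw [← RingHom.mapMatrix_apply, ← RingHom.map_det] at h1
    simpa using h1
  by_contra hodd
  rw [Nat.not_odd_iff_even] at hodd
  have hW2 : W.map (Int.castRingHom (ZMod 2)) = 1 := by
    ext k l
    by_cases hkl : k = l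
    · subst hkl
      have : (m : ZMod 2) = 0 := (ZMod.natCast_eq_zero_iff_even).mpr hodd
      simp [W, this]
    · have : s k l = 1 ∨ s k l = -1 := by
        simpa using hs k l
      rcases this with h1 | h1
      · simp [W, hkl, h1]
        decide
      · simp [W, hkl, h1]
  have := congrArg (Int.castRingHom (ZMod 2)) hdet
  rw [RingHom.map_det, RingHom.mapMatrix_apply, hW2] at this
  simp at this

end IsQuarticDesign

theorem mainTheorem5 (n : ℕ) (hn : 3 ≤ n)
    (h : ∃ (r : ℕ) (a : Fin r → Fin n → ℂ), IsTightDecomposition n 2 a) :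
    n = 3 ∨ ∃ m : ℕ, Odd m ∧ (n : ℤ) = (m : ℤ) ^ 2 - 2 := by
  obtain ⟨r, a, ha⟩ := h
  refine or_iff_not_imp_left.mpr fun hn3 => ?_
  have hn4 : 4 ≤ n := by omega
  have hr : 2 * r = (n + 1) * n := by rw [ha.1, two_mul_tightSize_two]
  obtain ⟨m, hm⟩ := ha.isQuarticDesign.isSquare_add_two hr hn4
  refine ⟨m, ha.isQuarticDesign.odd_of_sq_eq hr hn4 (by rw [hm, sq]), ?_⟩
  zify at hm
  linear_combination hm
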